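/- \textbf{Conventions.} Let $O(1)=\{+1,-1\}$ and $\mathbb{P}=BO(1)$, the one-object groupoid. A \emph{groupoid with parity} is a groupoid $X$ with a functor $X\to\mathbb{P}$; it assigns to every arrow $g$ a parity $\operatorname{par}(g)\in\{\pm1\}$, compatibly with composition (an arrow is even if its parity is $+1$, odd if it is $-1$). A morphism $X\to Y$ of groupoids with parity is a functor $u$ together with a natural transformation from $X\to\mathbb{P}$ to $X\xrightarrow{u}Y\to\mathbb{P}$, with components in $\{\pm1\}$. A \emph{span} from $S$ to $T$ consists of two such morphisms $S\xleftarrow{s}M\xrightarrow{t}T$; write $\epsilon',\epsilon$ for the natural transformations of its left and right leg. A morphism of spans $M\to N$ is a morphism of groupoids with parity $M\to N$ together with natural transformations filling the two triangles over $S$ and over $T$, such that the pasted natural transformations down to $\mathbb{P}$ agree on both sides; it is an \emph{equivalence} if its underlying functor $M\to N$ is an equivalence. A \emph{scalar} (signed scalar) is a span from $1$ to $1$, where $1$ is the terminal groupoid with its trivial parity structure; equivalently a groupoid split into a positive and a negative part, according to the sign $\epsilon'_a\epsilon_a$ of its objects $a$. The sum of scalars is disjoint union; the product of scalars is the cartesian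 product, with parities and natural transformations multiplied; for $\varepsilon\in\{\pm1\}$, the scalar $\varepsilon\cdot M$ is $M$ with $\epsilon$ replaced by $\varepsilon\,\epsilon$. For a span $S\xleftarrow{s}M\xrightarrow{t}T$ and points $x\in S$, $y\in T$, the \emph{two-sided fibre} ${}_xM_y$ is the homotopy limit of $1\xrightarrow{x}S\xleftarrow{s}M\xrightarrow{t}T\xleftarrow{y}1$: its objects are triples $(a,\ \alpha\colon x\to s(a),\ \beta\colon t(a)\to y)$ with $a\in M$, and its arrows are arrows $a\to a'$ of $M$ compatible with the $\alpha$'s and $\beta$'s. It is a scalar, with parities those of $M$ and with the pasted natural transformations $\epsilon'_a\operatorname{par}(\alpha)^{-1}$ and $\epsilon_a\operatorname{par}(\beta)$. For $k\in\mathbb{N}$, the \emph{exterior power} $\Lambda^kX$ is the weak quotient $X^k/\Sigma_k$: its objects are $k$-tuples of objects of $X$, and an arrow $(y_1,\dots,y_k)\to(x_1,\dots,x_k)$ is a permutation $\sigma\in\Sigma_k$ with arrows $\gamma_j\colon y_j\to x_{\sigma j}$ of $X$; its parity is $\operatorname{sign}(\sigma)\prod_j\operatorname{par}(\gamma_j)$.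 The exterior power of a span is formed by applying $\Lambda^k$ to the three groupoids and to the two legs, the natural transformations at a tuple being the products of their values at the entries. A point of a groupoid with parity is \emph{orientable} if it has no odd automorphisms; a connected component is orientable if its points are. \textbf{Proposition (Objective Leibniz expansion).} Let $X$ be a groupoid with parity with exactly $n$ orientable components, let $\underline x=(x_1,\dots,x_n)$ be a tuple of points of $X$, one in each orientable component, and let $X\xleftarrow{s}A\xrightarrow{t}X$ be a span of groupoids with parity. Then there is a canonical equivalence of scalars $$ {}_{\underline x}(\Lambda^nA)_{\underline x}\ \simeq\ \sum_{\sigma\in\Sigma_n}\operatorname{sign}(\sigma)\prod_{i=1}^n{}_{x_i}A_{x_{\sigma i}} . $$ Canonical means here: it is inverse, up to natural isomorphism of the underlying functors, to the functor that sends, in the summand of $\sigma$, the family $(a_i,\alpha_i,\beta_i)_{i}$ with $\alpha_i\colon x_i\to s(a_i)$ and $\beta_i\colon t(a_i)\to x_{\sigma i}$ to the tuple $(a_1,\dots,a_n)$ together with the arrows $(\operatorname{id},(\alpha_i)_i)\colon\underline x\to s(\underline a)$ and $(\sigma,(\beta_i)_i)\colon t(\underline a)\to\underline x$ of $\Lambda^nX$,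 and that sends a family of arrows $(\theta_i)_i$ to $(\operatorname{id},(\theta_i)_i)$. -/

import Mathlib

open CategoryTheory

set_option linter.checkUnivs false

namespace ObjectiveLinearAlgebra

noncomputable section

universe u v u₁ v₁ u₂ v₂ u₃ v₃ w

/-! ### Groupoids with parity: the 2-category of groupoids over `P = BO(1)` -/

/-- The one-object groupoid `P = BO(1)`, with `O(1) = ℤˣ = {+1, -1}`. -/
abbrev P : Type := SingleObj ℤˣ

/-- A groupoid with parity structure: a groupoid together with a functor to `P`. -/
structure PGrpd where
  carrier : Type u
  [str : Groupoid.{v} carrier]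
  par : carrier ⥤ P

namespace PGrpd

instance : CoeSort PGrpd.{u, v} (Type u) := ⟨PGrpd.carrier⟩

instance (X : PGrpd.{u, v}) : Groupoid.{v} X := X.str

/-- The parity of an arrow: `+1` is even, `-1` is odd. -/
def parity (X : PGrpd.{u, v}) {x y : X} (g : x ⟶ y) : ℤˣ := X.par.map g

theorem parity_id (X : PGrpd.{u, v}) (x : X) : X.parity (𝟙 x) = 1 :=
  X.par.map_id x

theorem parity_comp (X : PGrpd.{u, v}) {x y z : X} (g : x ⟶ y) (h : y ⟶ z) :
    X.parity (g ≫ h) = X.parity g * X.parity h :=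
  (X.par.map_comp g h).trans (mul_comm (X.parity h) (X.parity g))

/-- Build a groupoid with parity from an assignment of parities to arrows that is compatible
with composition. -/
abbrev ofParity (C : Type u) [Groupoid.{v} C] (p : ∀ {x y : C}, (x ⟶ y) → ℤˣ)
    (p_id : ∀ x : C, p (𝟙 x) = 1)
    (p_comp : ∀ {x y z : C} (g : x ⟶ y) (h : y ⟶ z), p (g ≫ h) = p g * p h) :
    PGrpd.{u, v} where
  carrier := C
  par :=
    { obj := fun _ => SingleObj.star ℤˣ
      map := fun g => p g
      map_id := fun x => p_id x
      map_comp := fun g h => (p_comp g h).trans (mul_comm _ _) }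

/-- The trivial parity structure `e : 1 → P` on the terminal groupoid. -/
def unit : PGrpd.{0, 0} :=
  ofParity (Discrete PUnit.{1}) (fun _ => 1) (fun _ => rfl) (fun _ _ => (mul_one 1).symm)

/-- A point is orientable if it has no odd automorphisms; a connected component is orientable
if its points are. -/
def IsOrientable (X : PGrpd.{u, v}) (x : X) : Prop :=
  ∀ g : x ⟶ x, X.parity g = 1

/-- `x₁, …, xₙ` are basepoints of the orientable components of `X`, exactly one for each
orientable component. -/
structure IsOrientableBasepoints (X : PGrpd.{u, v}) {n : ℕ} (x : Fin n → X) : Prop where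
  orientable : ∀ i, X.IsOrientable (x i)
  existsUnique : ∀ y : X, X.IsOrientable y → ∃! i, Nonempty (y ⟶ x i)

end PGrpd

/-- A morphism of groupoids with parity: a functor `u : X ⥤ Y` together with a natural
transformation `f ⟹ g ∘ u` (automatically invertible), where `f`, `g` are the maps to `P`. -/
structure PHom (X : PGrpd.{u, v}) (Y : PGrpd.{u₁, v₁}) where
  functor : X ⥤ Y
  cell : X.par ⟶ functor ⋙ Y.par

namespace PHom

/-- The components of the 2-cell, as elements of `{+1, -1}`. -/
def sign {X : PGrpd.{u, v}} {Y : PGrpd.{u₁, v₁}} (F : PHom X Y) (x : X) : ℤˣ := F.cell.app x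

theorem sign_naturality {X : PGrpd.{u, v}} {Y : PGrpd.{u₁, v₁}} (F : PHom X Y) {x y : X}
    (g : x ⟶ y) :
    X.parity g * F.sign y = F.sign x * Y.parity (F.functor.map g) :=
  by
  have h : F.sign y * X.parity g = Y.parity (F.functor.map g) * F.sign x := F.cell.naturality g
  rw [mul_comm, h, mul_comm]

/-- Build a morphism of groupoids with parity from the components of its 2-cell. -/
def ofSign {X : PGrpd.{u, v}} {Y : PGrpd.{u₁, v₁}} (F : X ⥤ Y) (s : X → ℤˣ)
    (nat : ∀ {x y : X} (g : x ⟶ y), X.parity g * s y = s x * Y.parity (F.map g)) :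
    PHom X Y where
  functor := F
  cell :=
    { app := fun x => s x
      naturality := fun _ _ g => (mul_comm _ _).trans ((nat g).trans (mul_comm _ _)) }

end PHom

/-! ### Spans over `P`, their morphisms, and scalars -/

/-- A span `S ⟵ M ⟶ T` of groupoids with parity (the two 2-cells are part of the legs). -/
structure PSpan (S : PGrpd.{u, v}) (T : PGrpd.{u₁, v₁}) where
  apex : PGrpd.{u₂, v₂}
  left : PHom apex S
  right : PHom apex T

namespace PSpan

variable {S : PGrpd.{u, v}} {T : PGrpd.{u₁, v₁}}

/-- A morphism `(u, θ, σ, τ)` of spans over `P`; the pair `(u, θ)` is the field `map`. The two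
equations say that the pasted 2-cells from the apex of `M` down to `P` agree on either side. -/
structure Hom (M : PSpan.{u, v, u₁, v₁, u₂, v₂} S T)
    (N : PSpan.{u, v, u₁, v₁, u₃, v₃} S T) where
  map : PHom M.apex N.apex
  σ : M.left.functor ⟶ map.functor ⋙ N.left.functor
  τ : M.right.functor ⟶ map.functor ⋙ N.right.functor
  left_eq : ∀ a : M.apex,
    map.sign a * N.left.sign (map.functor.obj a) = M.left.sign a * S.parity (σ.app a)
  right_eq : ∀ a : M.apex,
    map.sign a * N.right.sign (map.functor.obj a) = M.right.sign a * T.parity (τ.app a)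

/-- A morphism of spans is an equivalence if the functor between the apices is an equivalence
of groupoids. -/
def Hom.IsEquivalence {M : PSpan.{u, v, u₁, v₁, u₂, v₂} S T}
    {N : PSpan.{u, v, u₁, v₁, u₃, v₃} S T} (E : Hom M N) : Prop :=
  E.map.functor.IsEquivalence

/-- Multiplication of a span by a sign `ε`: the underlying span of groupoids is unchanged, and
the 2-cell on the right is multiplied by `ε`. For `ε = 1` this is the span itself, for `ε = -1`
it is the negative of the span. -/
def signMul (ε : ℤˣ) (M : PSpan.{u, v, u₁, v₁, u₂, v₂} S T) :
    PSpan.{u, v, u₁, v₁, u₂, v₂} S T where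
  apex := M.apex
  left := M.left
  right := PHom.ofSign M.right.functor (fun a => ε * M.right.sign a) (by
    intro a b g
    rw [mul_left_comm, M.right.sign_naturality g, mul_assoc])

end PSpan

/-- The disjoint union of a family of groupoids. -/
instance sigmaGroupoid {ι : Type w} {C : ι → Type u} [∀ i, Groupoid.{v} (C i)] :
    Groupoid (Σ i, C i) where
  inv := fun
    | .mk f => .mk (Groupoid.inv f)
  inv_comp := by
    rintro _ _ ⟨f⟩
    exact congrArg Sigma.SigmaHom.mk (Groupoid.inv_comp f)
  comp_inv := by
    rintro _ _ ⟨f⟩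
    exact congrArg Sigma.SigmaHom.mk (Groupoid.comp_inv f)

namespace PGrpd

/-- The sum (disjoint union) of a family of groupoids with parity. -/
def sum {ι : Type w} (X : ι → PGrpd.{u, v}) : PGrpd where
  carrier := Σ i, X i
  par := Sigma.desc fun i => (X i).par

/-- The convolution product of a finite family of groupoids with parity: the cartesian product
of the groupoids, the parity of a tuple of arrows being the product of the parities. -/
abbrev prod {ι : Type w} [Fintype ι] (X : ι → PGrpd.{u, v}) : PGrpd :=
  ofParity (∀ i, X i) (fun {x y} (g : ∀ i, x i ⟶ y i) => ∏ i, (X i).parity (g i))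
    (fun x => Finset.prod_eq_one fun i _ => (X i).parity_id (x i))
    (fun {x y z} (g : ∀ i, x i ⟶ y i) (h : ∀ i, y i ⟶ z i) =>
      (Finset.prod_congr rfl fun i _ => (X i).parity_comp (g i) (h i)).trans
        Finset.prod_mul_distrib)

end PGrpd

/-- The sum of a family of spans with fixed ends. -/
def PSpan.sum {S : PGrpd.{u, v}} {T : PGrpd.{u₁, v₁}} {ι : Type w}
    (M : ι → PSpan.{u, v, u₁, v₁, u₂, v₂} S T) : PSpan S T where
  apex := PGrpd.sum fun i => (M i).apex
  left :=
    { functor := Sigma.desc fun i => (M i).left.functor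
      cell := Sigma.natTrans fun i => (M i).left.cell }
  right :=
    { functor := Sigma.desc fun i => (M i).right.functor
      cell := Sigma.natTrans fun i => (M i).right.cell }

/-- A scalar is a span over `P` from `e : 1 → P` to itself. -/
abbrev Scalar := PSpan.{0, 0, 0, 0, u, v} PGrpd.unit PGrpd.unit

/-- The morphism to the unit `e : 1 → P` given by an orientation, that is, by a natural choice of
signs at the points. -/
def PHom.toUnit {X : PGrpd.{u, v}} (s : X → ℤˣ)
    (nat : ∀ {x y : X} (g : x ⟶ y), X.parity g * s y = s x) : PHom X PGrpd.unit :=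
  PHom.ofSign (Y := PGrpd.unit) (Functor.star X) s (fun g => (nat g).trans (mul_one _).symm)

/-- The product of a finite family of scalars: the convolution product of the apices, the
2-cells being multiplied. -/
def Scalar.prod {ι : Type w} [Fintype ι] (M : ι → Scalar.{u, v}) : Scalar where
  apex := PGrpd.prod fun i => (M i).apex
  left := PHom.toUnit (X := PGrpd.prod fun i => (M i).apex)
    (fun a : ∀ i, (M i).apex => ∏ i, (M i).left.sign (a i))
    (fun {a b : ∀ i, (M i).apex} (g : ∀ i, a i ⟶ b i) =>
      Finset.prod_mul_distrib.symm.trans (Finset.prod_congr rfl fun i _ =>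
        ((M i).left.sign_naturality (g i)).trans (mul_one _)))
  right := PHom.toUnit (X := PGrpd.prod fun i => (M i).apex)
    (fun a : ∀ i, (M i).apex => ∏ i, (M i).right.sign (a i))
    (fun {a b : ∀ i, (M i).apex} (g : ∀ i, a i ⟶ b i) =>
      Finset.prod_mul_distrib.symm.trans (Finset.prod_congr rfl fun i _ =>
        ((M i).right.sign_naturality (g i)).trans (mul_one _)))

/-! ### Two-sided fibres -/

section Fibre

variable {S : PGrpd.{u, v}} {T : PGrpd.{u₁, v₁}}

/-- Objects of the two-sided homotopy fibre `ₓM_y` of a span `S ⟵ M ⟶ T`, that is, of the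
homotopy limit of `1 → S ⟵ M ⟶ T ← 1`. -/
structure FibreObj (M : PSpan.{u, v, u₁, v₁, u₂, v₂} S T) (x : S) (y : T) where
  pt : M.apex
  fst : x ⟶ M.left.functor.obj pt
  snd : M.right.functor.obj pt ⟶ y

/-- Arrows of the two-sided homotopy fibre. -/
@[ext]
structure FibreHom {M : PSpan.{u, v, u₁, v₁, u₂, v₂} S T} {x : S} {y : T}
    (a b : FibreObj M x y) where
  hom : a.pt ⟶ b.pt
  fst_comp : a.fst ≫ M.left.functor.map hom = b.fst
  comp_snd : M.right.functor.map hom ≫ b.snd = a.snd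

instance fibreGroupoid (M : PSpan.{u, v, u₁, v₁, u₂, v₂} S T) (x : S) (y : T) :
    Groupoid.{v₂} (FibreObj M x y) where
  Hom a b := FibreHom a b
  id a := ⟨𝟙 a.pt, by simp, by simp⟩
  comp f g := ⟨f.hom ≫ g.hom,
    by rw [Functor.map_comp, ← Category.assoc, f.fst_comp, g.fst_comp],
    by rw [Functor.map_comp, Category.assoc, g.comp_snd, f.comp_snd]⟩
  id_comp f := FibreHom.ext (Category.id_comp f.hom)
  comp_id f := FibreHom.ext (Category.comp_id f.hom)
  assoc f g h := FibreHom.ext (Category.assoc f.hom g.hom h.hom)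
  inv f := ⟨inv f.hom, by simp [← f.fst_comp], by simp [← f.comp_snd]⟩
  inv_comp f := FibreHom.ext (IsIso.inv_hom_id f.hom)
  comp_inv f := FibreHom.ext (IsIso.hom_inv_id f.hom)

/-- The two-sided fibre `ₓM_y` as a scalar: its parity structure is the one of `M`, and its
2-cells are obtained by pasting those of `M` with the 2-cells of the homotopy pullbacks. -/
def PSpan.fibre (M : PSpan.{u, v, u₁, v₁, u₂, v₂} S T) (x : S) (y : T) : Scalar where
  apex := PGrpd.ofParity (FibreObj M x y) (fun g => M.apex.parity (FibreHom.hom g))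
    (fun a => M.apex.parity_id a.pt) (fun g h => M.apex.parity_comp g.hom h.hom)
  left := PHom.toUnit (X := PGrpd.ofParity (FibreObj M x y) _ _ _)
    (fun a : FibreObj M x y => M.left.sign a.pt * S.parity (inv a.fst)) (fun {a b} g => by
      have h : M.left.functor.map (FibreHom.hom g) ≫ inv (FibreObj.fst b) =
          inv (FibreObj.fst a) := by
        rw [IsIso.comp_inv_eq, IsIso.eq_inv_comp]
        exact FibreHom.fst_comp g
      change M.apex.parity (FibreHom.hom g) * (M.left.sign (FibreObj.pt b) * _) = _
      rw [← mul_assoc, M.left.sign_naturality, mul_assoc, ← S.parity_comp, h])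
  right := PHom.toUnit (X := PGrpd.ofParity (FibreObj M x y) _ _ _)
    (fun a : FibreObj M x y => M.right.sign a.pt * T.parity a.snd) (fun {a b} g => by
      change M.apex.parity (FibreHom.hom g) * (M.right.sign (FibreObj.pt b) * _) = _
      rw [← mul_assoc, M.right.sign_naturality, mul_assoc, ← T.parity_comp,
        FibreHom.comp_snd g])

end Fibre

/-! ### Exterior powers -/

/-- Objects of the exterior power `Λᵏ X`: `k`-tuples of objects of `X`. -/
structure ExtObj (k : ℕ) (X : PGrpd.{u, v}) where
  pt : Fin k → X

/-- An arrow `(y₁, …, y_k) ⟶ (x₁, …, x_k)` in the weak quotient `Xᵏ/Σ_k`: a permutation `σ`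
together with arrows `γ_j : y_j ⟶ x_{σ j}` of `X`. -/
structure ExtHom {k : ℕ} {X : PGrpd.{u, v}} (y x : ExtObj k X) where
  perm : Equiv.Perm (Fin k)
  hom : ∀ j, y.pt j ⟶ x.pt (perm j)

theorem ExtHom.ext' {k : ℕ} {X : PGrpd.{u, v}} {y x : ExtObj k X} {f g : ExtHom y x}
    (h : f.perm = g.perm)
    (h' : ∀ j, f.hom j ≫ eqToHom (congrArg (fun σ => x.pt (σ j)) h) = g.hom j) : f = g := by
  obtain ⟨σ, f⟩ := f
  obtain ⟨τ, g⟩ := g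
  obtain rfl : σ = τ := h
  congr 1
  funext j
  simpa using h' j

theorem ExtHom.inv_aux {k : ℕ} {X : PGrpd.{u, v}} {y x : ExtObj k X} (f : ExtHom y x)
    {i j : Fin k} (h : i = j) (h₁ : x.pt (f.perm j) = x.pt (f.perm i)) (h₂ : y.pt i = y.pt j) :
    (f.hom j ≫ eqToHom h₁ ≫ inv (f.hom i)) ≫ eqToHom h₂ = 𝟙 (y.pt j) := by
  subst h
  simp

theorem ExtHom.inv_aux' {k : ℕ} {X : PGrpd.{u, v}} {y x : ExtObj k X} (f : ExtHom y x)
    {i j : Fin k} (h₁ : x.pt j = x.pt (f.perm i)) (h₂ : x.pt (f.perm i) = x.pt j) :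
    ((eqToHom h₁ ≫ inv (f.hom i)) ≫ f.hom i) ≫ eqToHom h₂ = 𝟙 (x.pt j) := by
  simp

instance extGroupoid (k : ℕ) (X : PGrpd.{u, v}) : Groupoid.{v} (ExtObj k X) where
  Hom y x := ExtHom y x
  id x := ⟨1, fun j => 𝟙 (x.pt j)⟩
  comp f g := ⟨g.perm * f.perm, fun j => f.hom j ≫ g.hom (f.perm j)⟩
  id_comp f := congrArg (ExtHom.mk f.perm) (funext fun j => Category.id_comp (f.hom j))
  comp_id f := congrArg (ExtHom.mk f.perm) (funext fun j => Category.comp_id (f.hom j))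
  assoc f g h := congrArg (ExtHom.mk (h.perm * g.perm * f.perm))
    (funext fun j => Category.assoc (f.hom j) (g.hom (f.perm j)) (h.hom (g.perm (f.perm j))))
  inv {_ x} f := ⟨f.perm⁻¹, fun j =>
    eqToHom (congrArg x.pt (f.perm.apply_symm_apply j).symm) ≫ inv (f.hom (f.perm⁻¹ j))⟩
  inv_comp f := ExtHom.ext' (mul_inv_cancel f.perm) fun _ => f.inv_aux' _ _
  comp_inv f := ExtHom.ext' (inv_mul_cancel f.perm) fun j =>
    f.inv_aux (f.perm.symm_apply_apply j) _ _

/-- The `k`-th exterior power: the weak quotient `Xᵏ/Σ_k`, the parity of an arrow `(σ, γ)` being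
the sign of `σ` times the product of the parities of the `γ_j`. -/
abbrev extPow (k : ℕ) (X : PGrpd.{u, v}) : PGrpd.{u, v} :=
  PGrpd.ofParity (ExtObj k X)
    (fun (g : ExtHom _ _) => Equiv.Perm.sign g.perm * ∏ j, X.parity (g.hom j))
    (fun x => by
      change Equiv.Perm.sign 1 * ∏ j, X.parity (𝟙 (x.pt j)) = 1
      simp [PGrpd.parity_id])
    (fun {x y z} (g : ExtHom x y) (h : ExtHom y z) => by
      change Equiv.Perm.sign (h.perm * g.perm) *
        ∏ j, X.parity (g.hom j ≫ h.hom (g.perm j)) = _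
      simp only [PGrpd.parity_comp, Finset.prod_mul_distrib, Equiv.Perm.sign_mul]
      rw [Equiv.prod_comp g.perm fun j => X.parity (h.hom j),
        mul_comm (Equiv.Perm.sign h.perm), mul_mul_mul_comm])

/-- Functoriality of the exterior power: everything is applied componentwise. -/
abbrev PHom.extPow (k : ℕ) {X : PGrpd.{u, v}} {Y : PGrpd.{u₁, v₁}} (F : PHom X Y) :
    PHom (ObjectiveLinearAlgebra.extPow k X) (ObjectiveLinearAlgebra.extPow k Y) :=
  PHom.ofSign
    (X := ObjectiveLinearAlgebra.extPow k X) (Y := ObjectiveLinearAlgebra.extPow k Y)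
    { obj := fun x : ExtObj k X => (⟨fun j => F.functor.obj (x.pt j)⟩ : ExtObj k Y)
      map := fun {y x} (g : ExtHom y x) => ⟨g.perm, fun j => F.functor.map (g.hom j)⟩
      map_id := fun x => congrArg (ExtHom.mk 1) (funext fun j => F.functor.map_id (x.pt j))
      map_comp := fun {_ _ _} (g : ExtHom _ _) (h : ExtHom _ _) =>
        congrArg (ExtHom.mk (h.perm * g.perm))
          (funext fun j => F.functor.map_comp (g.hom j) (h.hom (g.perm j))) }
    (fun x : ExtObj k X => ∏ j, F.sign (x.pt j))
    (fun {y x : ExtObj k X} (g : ExtHom y x) => by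
      change (Equiv.Perm.sign g.perm * ∏ j, X.parity (g.hom j)) * ∏ j, F.sign (x.pt j) =
        (∏ j, F.sign (y.pt j)) *
          (Equiv.Perm.sign g.perm * ∏ j, Y.parity (F.functor.map (g.hom j)))
      rw [← Equiv.prod_comp g.perm fun j => F.sign (x.pt j), mul_assoc,
        ← Finset.prod_mul_distrib, mul_left_comm, ← Finset.prod_mul_distrib]
      simp only [PHom.sign_naturality])

/-- The exterior power of a span. -/
abbrev PSpan.extPow (k : ℕ) {S : PGrpd.{u, v}} {T : PGrpd.{u₁, v₁}}
    (M : PSpan.{u, v, u₁, v₁, u₂, v₂} S T) :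
    PSpan (ObjectiveLinearAlgebra.extPow k S) (ObjectiveLinearAlgebra.extPow k T) where
  apex := ObjectiveLinearAlgebra.extPow k M.apex
  left := M.left.extPow k
  right := M.right.extPow k

/-! ### The comparison functor of the Leibniz expansion -/

section Leibniz

variable {X : PGrpd.{u, v}} (A : PSpan.{u, v, u, v, u₂, v₂} X X) {n : ℕ} (x : Fin n → X)

/-- The canonical comparison functor, on objects: for each `σ`, the tuple of objects
`(a_i, α_i : x_i ⟶ s a_i, β_i : t a_i ⟶ x_{σ i})` goes to the tuple `(a_i)` together with the
arrows `(id, α) : x ⟶ s a` and `(σ, β) : t a ⟶ x` of `Λⁿ X`. -/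
def leibnizObj (σ : Equiv.Perm (Fin n)) (b : ∀ i, FibreObj A (x i) (x (σ i))) :
    FibreObj (A.extPow n) (⟨x⟩ : ExtObj n X) (⟨x⟩ : ExtObj n X) where
  pt := (⟨fun i => (b i).pt⟩ : ExtObj n A.apex)
  fst := (⟨1, fun i => (b i).fst⟩ : ExtHom _ _)
  snd := (⟨σ, fun i => (b i).snd⟩ : ExtHom _ _)

/-- The canonical comparison functor, on arrows. -/
def leibnizMap (σ : Equiv.Perm (Fin n)) {b c : ∀ i, FibreObj A (x i) (x (σ i))}
    (g : ∀ i, FibreHom (b i) (c i)) : FibreHom (leibnizObj A x σ b) (leibnizObj A x σ c) where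
  hom := (⟨1, fun i => (g i).hom⟩ : ExtHom _ _)
  fst_comp := by
    have h : (fun i => (b i).fst ≫ A.left.functor.map (g i).hom) = fun i => (c i).fst :=
      funext fun i => (g i).fst_comp
    exact congrArg (ExtHom.mk (y := (⟨x⟩ : ExtObj n X))
      (x := ⟨fun i => A.left.functor.obj (c i).pt⟩) 1) h
  comp_snd := by
    have h : (fun i => A.right.functor.map (g i).hom ≫ (c i).snd) = fun i => (b i).snd :=
      funext fun i => (g i).comp_snd
    exact congrArg (ExtHom.mk (y := ⟨fun i => A.right.functor.obj (b i).pt⟩)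
      (x := (⟨x⟩ : ExtObj n X)) σ) h

/-- The canonical comparison functor from the apex of the Leibniz expansion to the apex of the
two-sided fibre of the exterior power. -/
def leibnizFunctor :
    (PSpan.sum fun σ : Equiv.Perm (Fin n) => PSpan.signMul (Equiv.Perm.sign σ)
      (Scalar.prod fun i => A.fibre (x i) (x (σ i)))).apex ⥤
    ((A.extPow n).fibre (⟨x⟩ : ExtObj n X) (⟨x⟩ : ExtObj n X)).apex :=
  Sigma.desc fun σ =>
    { obj := fun b => leibnizObj A x σ b
      map := fun g => leibnizMap A x σ g
      map_id := fun _ => rfl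
      map_comp := fun _ _ => rfl }

end Leibniz

end

end ObjectiveLinearAlgebra

open ObjectiveLinearAlgebra

namespace ObjectiveLinearAlgebra

noncomputable section

universe u v u₁ v₁ u₂ v₂ u₃ v₃

/-! A point of the fibre of `Λⁿ A` is a tuple `a` with arrows `(ρ, α) : x ⟶ s a` and `(τ, β) : t a ⟶
x`. Reordering `a` along `ρ` makes the first permutation trivial and turns the second into `τ * ρ`,
so every point is isomorphic to one in the summand of `τ * ρ` (`leibnizFunctor_essSurj`). Once the
first permutation is trivial the symmetry is used up: an arrow between two such points must carry
the identity permutation and preserve the second one (`leibnizObj_perm_eq`), hence is just a family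
of arrows between the fibres of `A`. So the comparison functor is an equivalence. The parity of `(σ,
β)` contributes the factor `sign σ`, and all other signs agree entry by entry (`leibnizHom`). The
required equivalence runs the opposite way; it comes from the general fact that an equivalence of
spans over `P` has an inverse with its own 2-cells (`PSpan.Hom.inverse`). -/

/-! ### Inverting equivalences of spans over `P` -/

theorem sign_mul_eq_of_eq {p l m n q s t : ℤˣ} (h : p * m = q * t) (h' : l * m = n * s) :
    p * l * n = q * (t * s) := by
  have hn : n = l * m * s := by rw [h', mul_assoc, Int.units_mul_self, mul_one]
  rw [← mul_assoc, ← h, hn, mul_assoc p l, mul_assoc l m s, ← mul_assoc l, Int.units_mul_self,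
    one_mul, ← mul_assoc]

theorem PGrpd.parity_inv (X : PGrpd.{u, v}) {x y : X} (g : x ⟶ y) :
    X.parity (inv g) = X.parity g := by
  have h : X.parity g * X.parity (inv g) = 1 := by
    rw [← X.parity_comp, IsIso.hom_inv_id, X.parity_id]
  rw [mul_eq_one_iff_inv_eq] at h
  rw [← h, Int.units_inv_eq_self]

theorem PGrpd.unit_hom_ext {x y : PGrpd.unit} (f g : x ⟶ y) : f = g :=
  ULift.ext _ _ (Subsingleton.elim _ _)

/-- A triangle of functors to a groupoid with one side an equivalence, filled the other way
along the inverse equivalence. -/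
def mateInverse {C : Type u₁} [Category.{v₁} C] {D : Type u₂} [Category.{v₂} D] {G : Type u}
    [Groupoid.{v} G] (e : C ≌ D) {P : C ⥤ G} {Q : D ⥤ G} (α : P ⟶ e.functor ⋙ Q) :
    Q ⟶ e.inverse ⋙ P where
  app a := Q.map (e.counitInv.app a) ≫ Groupoid.inv (α.app (e.inverse.obj a))
  naturality a b g := by
    have h := Q.congr_map (e.counitInv.naturality g)
    have h' := α.naturality (e.inverse.map g)
    simp only [Functor.map_comp, Functor.comp_map, Functor.id_map] at h h' ⊢
    rw [Groupoid.inv_eq_inv, Groupoid.inv_eq_inv, ← Category.assoc, IsIso.comp_inv_eq,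
      Category.assoc, Category.assoc, h', IsIso.inv_hom_id_assoc, h]

namespace PSpan

variable {S : PGrpd.{u, v}} {T : PGrpd.{u₁, v₁}}

/-- An inverse of an equivalence of spans. -/
def Hom.inverse {N : PSpan.{u, v, u₁, v₁, u₂, v₂} S T}
    {M : PSpan.{u, v, u₁, v₁, u₃, v₃} S T} (L : Hom N M) (hL : L.IsEquivalence) : Hom M N :=
  haveI : L.map.functor.IsEquivalence := hL
  let e := L.map.functor.asEquivalence
  { map := PHom.ofSign e.inverse
      -- The pasting of the parity along `a ⟶ L (L⁻¹ a)` with the inverse of the 2-cell of `L` at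
      -- `L⁻¹ a`; a sign is its own inverse.
      (fun a => M.apex.parity (e.counitInv.app a) * L.map.sign (e.inverse.obj a)) (by
        intro a b g
        have h := congrArg M.apex.parity (e.counitInv.naturality g)
        have h' := L.map.sign_naturality (e.inverse.map g)
        rw [M.apex.parity_comp, M.apex.parity_comp] at h
        change M.apex.parity g * M.apex.parity (e.counitInv.app b) =
          M.apex.parity (e.counitInv.app a) *
            M.apex.parity (L.map.functor.map (e.inverse.map g)) at h
        rw [← mul_assoc, h, mul_assoc, mul_assoc]
        congr 1
        rw [← mul_right_inj (L.map.sign (e.inverse.obj a)), ← mul_assoc]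
        change L.map.sign _ * M.apex.parity (L.map.functor.map (e.inverse.map g)) * _ = _
        rw [← h', mul_assoc, Int.units_mul_self, mul_one, ← mul_assoc, Int.units_mul_self,
          one_mul])
    σ := mateInverse e L.σ
    τ := mateInverse e L.τ
    left_eq := fun a => by
      -- Naturality of the leg of `M` along `a ⟶ L (L⁻¹ a)` and the pasting equation of `L` at `L⁻¹
      -- a` share the sign of that leg at `L (L⁻¹ a)`; eliminating it gives the claim, up to
      -- replacing `L.σ` by its inverse, which has the same parity.
      have h := sign_mul_eq_of_eq (M.left.sign_naturality (e.counitInv.app a))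
        (L.left_eq (e.inverse.obj a))
      rw [← S.parity_inv (L.σ.app _), ← Groupoid.inv_eq_inv] at h
      exact h.trans (congrArg _ (S.parity_comp _ _).symm)
    right_eq := fun a => by
      have h := sign_mul_eq_of_eq (M.right.sign_naturality (e.counitInv.app a))
        (L.right_eq (e.inverse.obj a))
      rw [← T.parity_inv (L.τ.app _), ← Groupoid.inv_eq_inv] at h
      exact h.trans (congrArg _ (T.parity_comp _ _).symm) }

theorem Hom.inverse_isEquivalence {N : PSpan.{u, v, u₁, v₁, u₂, v₂} S T}
    {M : PSpan.{u, v, u₁, v₁, u₃, v₃} S T} (L : Hom N M) (hL : L.IsEquivalence) :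
    (L.inverse hL).IsEquivalence :=
  haveI : L.map.functor.IsEquivalence := hL
  inferInstanceAs L.map.functor.asEquivalence.inverse.IsEquivalence

/-- The inverse of an equivalence of spans is a left inverse up to natural isomorphism. -/
def Hom.compInverseIso {N : PSpan.{u, v, u₁, v₁, u₂, v₂} S T}
    {M : PSpan.{u, v, u₁, v₁, u₃, v₃} S T} (L : Hom N M) (hL : L.IsEquivalence) :
    L.map.functor ⋙ (L.inverse hL).map.functor ≅ 𝟭 _ :=
  haveI : L.map.functor.IsEquivalence := hL
  L.map.functor.asEquivalence.unitIso.symm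

end PSpan

/-! ### The comparison functor is an equivalence compatible with signs -/

section Leibniz

variable {X : PGrpd.{u, v}} (A : PSpan.{u, v, u, v, u₂, v₂} X X) {n : ℕ} (x : Fin n → X)

/-- Serves to replace a permutation known only up to a propositional equality by a fixed one, so
that the components can be compared without transport. -/
theorem ExtHom.exists_eq_mk {k : ℕ} {X : PGrpd.{u, v}} {y x : ExtObj k X} (f : ExtHom y x)
    {σ : Equiv.Perm (Fin k)} (h : f.perm = σ) :
    ∃ γ : ∀ j, y.pt j ⟶ x.pt (σ j), f = ⟨σ, γ⟩ := by
  subst h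
  exact ⟨f.hom, rfl⟩

theorem ExtHom.mk_injective {k : ℕ} {X : PGrpd.{u, v}} {y x : ExtObj k X}
    (σ : Equiv.Perm (Fin k)) :
    Function.Injective (ExtHom.mk (y := y) (x := x) σ) := by
  intro γ δ h
  cases h
  rfl

theorem leibnizMap_injective (σ : Equiv.Perm (Fin n))
    {b c : ∀ i, FibreObj A (x i) (x (σ i))} :
    Function.Injective (leibnizMap A x σ (b := b) (c := c)) := by
  intro g h e
  have e' := ExtHom.mk_injective (y := ⟨fun i => (b i).pt⟩) (x := ⟨fun i => (c i).pt⟩) 1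
    (congrArg FibreHom.hom e)
  funext i
  exact FibreHom.ext (congrFun e' i)

/-- Compare permutations in the two compatibility triangles: both first arrows lie over `1`, which
forces the permutation of `g` to be `1`; the second arrows lie over `σ` and `τ`, which must then
coincide. -/
theorem leibnizObj_perm_eq {σ τ : Equiv.Perm (Fin n)}
    {b : ∀ i, FibreObj A (x i) (x (σ i))} {c : ∀ i, FibreObj A (x i) (x (τ i))}
    (g : FibreHom (leibnizObj A x σ b) (leibnizObj A x τ c)) :
    ExtHom.perm g.hom = 1 ∧ σ = τ := by
  have h₁ : ExtHom.perm g.hom * 1 = 1 := congrArg ExtHom.perm g.fst_comp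
  have h₂ : τ * ExtHom.perm g.hom = σ := congrArg ExtHom.perm g.comp_snd
  rw [mul_one] at h₁
  rw [h₁, mul_one] at h₂
  exact ⟨h₁, h₂.symm⟩

/-- Over the identity permutation, the two triangles in `Λⁿ X` split into one pair of triangles in
`X` for each index. -/
theorem leibnizMap_surjective (σ : Equiv.Perm (Fin n))
    {b c : ∀ i, FibreObj A (x i) (x (σ i))} :
    Function.Surjective (leibnizMap A x σ (b := b) (c := c)) := by
  rintro g
  have hp := (leibnizObj_perm_eq A x g).1
  obtain ⟨g, h₁, h₂⟩ := g
  obtain ⟨γ, rfl⟩ := ExtHom.exists_eq_mk g hp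
  have h₁' := ExtHom.mk_injective (y := (⟨x⟩ : ExtObj n X))
    (x := ⟨fun i => A.left.functor.obj (c i).pt⟩) 1 h₁
  have h₂' := ExtHom.mk_injective (y := ⟨fun i => A.right.functor.obj (b i).pt⟩)
    (x := (⟨x⟩ : ExtObj n X)) σ h₂
  exact ⟨fun i => ⟨γ i, congrFun h₁' i, congrFun h₂' i⟩, rfl⟩

instance leibnizFunctor_faithful : (leibnizFunctor A x).Faithful where
  map_injective := by
    rintro ⟨σ, b⟩ ⟨_, c⟩ ⟨g⟩ ⟨h⟩ e
    exact congrArg Sigma.SigmaHom.mk (leibnizMap_injective A x σ e)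

instance leibnizFunctor_full : (leibnizFunctor A x).Full where
  map_surjective := by
    rintro ⟨σ, b⟩ ⟨τ, c⟩ g
    obtain rfl : σ = τ := (leibnizObj_perm_eq A x g).2
    obtain ⟨g, rfl⟩ := leibnizMap_surjective A x σ g
    exact ⟨Sigma.SigmaHom.mk g, rfl⟩

/-- Reindexing the underlying tuple of a point of the fibre of `Λⁿ A` along the permutation of
its first arrow brings the point into the image of the comparison functor. -/
instance leibnizFunctor_essSurj : (leibnizFunctor A x).EssSurj where
  mem_essImage := by
    rintro ⟨⟨a⟩, ⟨ρ, α⟩, ⟨τ, β⟩⟩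
    -- Here `α i : x i ⟶ s (a (ρ i))`, so the entry at `i` has to be `a (ρ i)`, and `β (ρ i)` ends
    -- at `x (τ (ρ i))`. The isomorphism to the given point is `ρ` with identity components.
    refine ⟨⟨τ * ρ, fun i => ⟨a (ρ i), α i, β (ρ i)⟩⟩, ⟨?_⟩⟩
    refine Groupoid.isoEquivHom _ _ |>.symm ?_
    refine FibreHom.mk (⟨ρ, fun i => 𝟙 (a (ρ i))⟩ : ExtHom _ _) ?_ ?_
    · refine congrArg (ExtHom.mk (y := (⟨x⟩ : ExtObj n X))
        (x := ⟨fun i => A.left.functor.obj (a i)⟩) ρ) (funext fun i => ?_)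
      exact (congrArg (α i ≫ ·) (A.left.functor.map_id _)).trans (Category.comp_id _)
    · refine congrArg (ExtHom.mk (y := ⟨fun i => A.right.functor.obj (a (ρ i))⟩)
        (x := (⟨x⟩ : ExtObj n X)) (τ * ρ)) (funext fun i => ?_)
      exact (congrArg (· ≫ β (ρ i)) (A.right.functor.map_id _)).trans (Category.id_comp _)

/-- The comparison functor as a morphism of scalars. -/
def leibnizHom :
    PSpan.Hom
      (PSpan.sum fun σ : Equiv.Perm (Fin n) => PSpan.signMul (Equiv.Perm.sign σ)
        (Scalar.prod fun i => A.fibre (x i) (x (σ i))))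
      ((A.extPow n).fibre (⟨x⟩ : ExtObj n X) (⟨x⟩ : ExtObj n X)) where
  -- No correcting signs are needed: arrows are sent to arrows over the identity permutation, so
  -- parities are preserved.
  map := PHom.ofSign (leibnizFunctor A x) (fun _ => 1) (by
    rintro ⟨σ, b⟩ ⟨_, c⟩ ⟨g⟩
    rw [mul_one, one_mul]
    change (∏ i, A.apex.parity (FibreHom.hom (g i))) =
      Equiv.Perm.sign 1 * ∏ i, A.apex.parity (FibreHom.hom (g i))
    rw [Equiv.Perm.sign_one, one_mul])
  σ := { app := fun _ => 𝟙 _, naturality := fun _ _ _ => PGrpd.unit_hom_ext _ _ }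
  τ := { app := fun _ => 𝟙 _, naturality := fun _ _ _ => PGrpd.unit_hom_ext _ _ }
  left_eq := by
    rintro ⟨σ, b⟩
    change 1 * ((∏ i, A.left.sign (b i).pt) * (extPow n X).parity (inv (leibnizObj A x σ b).fst))
      = (∏ i, (A.left.sign (b i).pt * X.parity (inv (b i).fst))) * 1
    rw [one_mul, mul_one, PGrpd.parity_inv, Finset.prod_mul_distrib]
    simp only [PGrpd.parity_inv]
    congr 1
    change Equiv.Perm.sign 1 * (∏ i, X.parity (b i).fst) = _
    rw [Equiv.Perm.sign_one, one_mul]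
  right_eq := by
    rintro ⟨σ, b⟩
    -- On the left side `sign σ` is part of the parity of the second arrow `(σ, β)` in `Λⁿ X`; on
    -- the right side it is the factor put in by `signMul`.
    change 1 * ((∏ i, A.right.sign (b i).pt) *
        (Equiv.Perm.sign σ * ∏ i, X.parity (b i).snd)) =
      (Equiv.Perm.sign σ * ∏ i, (A.right.sign (b i).pt * X.parity (b i).snd)) * 1
    rw [one_mul, mul_one, Finset.prod_mul_distrib, mul_left_comm]

theorem leibnizHom_isEquivalence : (leibnizHom A x).IsEquivalence :=
  show (leibnizFunctor A x).IsEquivalence from {}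

end Leibniz

end

end ObjectiveLinearAlgebra

open ObjectiveLinearAlgebra
theorem mainTheorem1 {X : PGrpd} (A : PSpan X X) {n : ℕ} (x : Fin n → X)
    (hx : X.IsOrientableBasepoints x) :
    ∃ E : PSpan.Hom ((A.extPow n).fibre (⟨x⟩ : ExtObj n X) (⟨x⟩ : ExtObj n X))
        (PSpan.sum fun σ : Equiv.Perm (Fin n) =>
          PSpan.signMul (Equiv.Perm.sign σ) (Scalar.prod fun i => A.fibre (x i) (x (σ i)))),
      E.IsEquivalence ∧ Nonempty (leibnizFunctor A x ⋙ E.map.functor ≅ 𝟭 _) :=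
  ⟨(leibnizHom A x).inverse (leibnizHom_isEquivalence A x),
    (leibnizHom A x).inverse_isEquivalence (leibnizHom_isEquivalence A x),
    ⟨(leibnizHom A x).compInverseIso (leibnizHom_isEquivalence A x)⟩⟩
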